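/- There exist universal constants $C>0$ and $C'>0$ such that the following holds for all integers $n,p\ge 1$ and $k\ge 2$, all centers $\theta_1^*,\dots,\theta_k^*\in\mathbb R^p$ and all assignment vectors $z^*\in[k]^n$, where $[k]=\{1,\dots,k\}$. Put $$\Delta=\min_{j\ne l}\|\theta_j^*-\theta_l^*\|,\qquad \beta=\frac{\min_{j\in[k]}|\{i\in[n]:z_i^*=j\}|}{n/k},\qquad \ell(z,z^*)=\min_{\phi}\frac1n\sum_{i=1}^n\mathbb 1\{\phi(z_i)\neq z_i^*\},$$ where $\phi$ ranges over the bijections of $[k]$. Observe $X_i=\theta^*_{z_i^*}+\epsilon_i$, $i\in[n]$, where $\epsilon_1,\dots,\epsilon_n$ are independent $\mathcal N(0,I_p)$ vectors, and let $X=(X_1,\dots,X_n)\in\mathbb R^{p\times n}$. An output $\hat z\in[k]^n$ of spectral clustering is obtained as follows. Take a singular value decomposition $X=\sum_{l=1}^{p\wedge n}\hat\sigma_l\hat u_l\hat v_l^T$ with $\hat\sigma_1\ge\hat\sigma_2\ge\dots\ge 0$ and orthonormal families $(\hat u_l)$, $(\hat v_l)$; let $r=\min\{k,p,n\}$, $\hat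 U=(\hat u_1,\dots,\hat u_r)$ and $\hat Y=\hat U^TX\in\mathbb R^{r\times n}$; let $(\hat z,(\hat c_j)_{j\in[k]})$ be a global minimizer of $\sum_{i=1}^n\|\hat Y_{\cdot,i}-c_{z_i}\|^2$ over $z\in[k]^n$ and $c_1,\dots,c_k\in\mathbb R^r$. If all clusters are non-empty (that is, $\beta>0$) and $$\frac{\Delta}{\beta^{-1/2}\,k\,(1+p/n)^{1/2}}\ \ge\ C,$$ then there is an event of probability at least $1-\exp(-0.08\,n)$ on which every output $\hat z$ of spectral clustering (for every choice of the singular value decomposition and of the $k$-means minimizer) satisfies $$\ell(\hat z,z^*)\ \le\ \frac{C'\,k\,(1+p/n)}{\Delta^2}.$$ No condition on the singular values or their gaps is assumed. -/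

import Mathlib

open MeasureTheory ProbabilityTheory

namespace SpectralClustering

noncomputable section

/-- The misclustering error `ℓ(z, z*)`: the fraction of misclustered labels, minimized over all
relabelings of the `k` symbols (a minimum over the finite nonempty set of permutations). -/
def misclusteringError {n k : ℕ} (z zstar : Fin n → Fin k) : ℝ :=
  ⨅ φ : Equiv.Perm (Fin k),
    (1 / (n : ℝ)) * ((Finset.univ.filter fun i : Fin n => φ (z i) ≠ zstar i).card : ℝ)

/-- `Δ`, the minimum distance between two different centers (a minimum over a finite set, which is
nonempty when `k ≥ 2`). -/
def minSeparation {p k : ℕ} (θ : Fin k → EuclideanSpace ℝ (Fin p)) : ℝ :=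
  ⨅ jl : {jl : Fin k × Fin k // jl.1 ≠ jl.2}, ‖θ jl.1.1 - θ jl.1.2‖

/-- `β`, the size of the smallest cluster divided by `n / k`. -/
def clusterBalance {n k : ℕ} (zstar : Fin n → Fin k) : ℝ :=
  (⨅ j : Fin k, ((Finset.univ.filter fun i : Fin n => zstar i = j).card : ℝ)) /
    ((n : ℝ) / (k : ℝ))

/-- `(σ, u, v)` is a singular value decomposition `X = ∑ l, σ l • u l (v l)ᵀ` of the `p × n` matrix
whose `i`-th column is `X i`, with `min p n` nonnegative singular values in decreasing order. -/
structure IsSVD {p n : ℕ} (X : Fin n → EuclideanSpace ℝ (Fin p))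
    (σ : Fin (min p n) → ℝ) (u : Fin (min p n) → EuclideanSpace ℝ (Fin p))
    (v : Fin (min p n) → EuclideanSpace ℝ (Fin n)) : Prop where
  antitone : Antitone σ
  nonneg : ∀ l, 0 ≤ σ l
  left_orthonormal : Orthonormal ℝ u
  right_orthonormal : Orthonormal ℝ v
  decomposition : ∀ i, X i = ∑ l, (σ l * v l i) • u l

/-- The columns of `Ŷ = Ûᵀ X`, where the columns of `Û` are the leading left singular vectors:
the first `k` of them, or all `min p n` of them if there are fewer than `k`. -/
def projectedData {p n : ℕ} (k : ℕ) (X : Fin n → EuclideanSpace ℝ (Fin p))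
    (u : Fin (min p n) → EuclideanSpace ℝ (Fin p)) :
    Fin n → EuclideanSpace ℝ (Fin (min k (min p n))) :=
  fun i => WithLp.toLp 2 fun l => inner ℝ (u (Fin.castLE (min_le_right k (min p n)) l)) (X i)

/-- `(z, c)` is a global minimizer of the `k`-means objective on the points `Y i`. -/
def IsKMeansSolution {n k d : ℕ} (Y : Fin n → EuclideanSpace ℝ (Fin d))
    (z : Fin n → Fin k) (c : Fin k → EuclideanSpace ℝ (Fin d)) : Prop :=
  ∀ (z' : Fin n → Fin k) (c' : Fin k → EuclideanSpace ℝ (Fin d)),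
    ∑ i, ‖Y i - c (z i)‖ ^ 2 ≤ ∑ i, ‖Y i - c' (z' i)‖ ^ 2

/-- `z` is an output of spectral clustering with `k` clusters on the data points `X i`: it comes
from some singular value decomposition of the data matrix followed by some exact solution of
`k`-means on the columns of `Ŷ`. (Neither of the two is unique in general.) -/
def IsSpectralClusteringOutput {p n k : ℕ} (X : Fin n → EuclideanSpace ℝ (Fin p))
    (z : Fin n → Fin k) : Prop :=
  ∃ (σ : Fin (min p n) → ℝ) (u : Fin (min p n) → EuclideanSpace ℝ (Fin p))
    (v : Fin (min p n) → EuclideanSpace ℝ (Fin n))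
    (c : Fin k → EuclideanSpace ℝ (Fin (min k (min p n)))),
    IsSVD X σ u v ∧ IsKMeansSolution (projectedData k X u) z c

end

end SpectralClustering

namespace SpectralClustering

/-! ### Operator norm of a Gaussian matrix -/

section Gaussian

/-! Write `X = P + E` with signal `P` and noise `E`. Randomness enters only through `‖E‖² ≤ 50 (n +
p)`; the rest is deterministic.

No singular gap is needed because `P` has rank at most `k`. Hence the singular values of `X` past
the `k`-th are at most `‖E‖`, and removing the leading singular directions leaves at most `2‖E‖` of
`P` in operator norm. Testing this on cluster indicators bounds the lost part of each center, at a
total cost of `4k‖E‖²` over the data. The projected noise has at most `k` rows, so its Frobenius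
norm squared is at most `k‖E‖²`; comparing k-means with the true labels and projected true centers
bounds its objective by the same quantity. Thus the lifted estimated centers are within `18k‖E‖²` of
the true ones in summed squares (`IsSVD.sum_norm_sq_lifted_center_sub_center_le`). Few points then
have an error of `Δ/2` or more, fewer than any cluster contains, and the others determine the
relabeling (`exists_perm_card_ne_le`).

The noise bound replaces an ε-net by Markov's inequality for the integral of `exp (4/25 ‖E y‖²)`
over a ball: a large `‖E‖` makes the integrand large on a whole small ball around a near-maximizer.
-/

lemma gaussianPDFReal_mul_exp_quarter_sq (x : ℝ) :
    gaussianPDFReal 0 1 x * Real.exp (1 / 4 * x ^ 2) =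
      (√(2 * Real.pi))⁻¹ * Real.exp (-(1 / 4) * x ^ 2) := by
  rw [gaussianPDFReal_def]
  simp only [NNReal.coe_one, mul_one, sub_zero]
  rw [mul_assoc, ← Real.exp_add]
  congr 2
  ring

lemma integral_exp_quarter_sq_gaussianReal :
    ∫ x, Real.exp (1 / 4 * x ^ 2) ∂(gaussianReal 0 1) = √2 := by
  rw [integral_gaussianReal_eq_integral_smul one_ne_zero]
  simp only [smul_eq_mul, gaussianPDFReal_mul_exp_quarter_sq]
  rw [integral_const_mul, integral_gaussian, ← Real.sqrt_inv, ← Real.sqrt_mul (by positivity)]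
  congr 1
  field_simp
  norm_num

lemma integrable_exp_quarter_sq_gaussianReal :
    Integrable (fun x : ℝ => Real.exp (1 / 4 * x ^ 2)) (gaussianReal 0 1) :=
  -- A non-integrable function has integral `0` by convention, so the nonzero value already gives
  -- integrability.
  Integrable.of_integral_ne_zero (by rw [integral_exp_quarter_sq_gaussianReal]; positivity)

lemma lintegral_exp_quarter_norm_sq_stdGaussian (p : ℕ) :
    ∫⁻ x, ENNReal.ofReal (Real.exp (1 / 4 * ‖x‖ ^ 2))
      ∂(stdGaussian (EuclideanSpace ℝ (Fin p))) = ENNReal.ofReal (√2 ^ p) := by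
  rw [← map_pi_eq_stdGaussian, lintegral_map (by fun_prop) (by fun_prop)]
  have h : ∀ x : Fin p → ℝ, Real.exp (1 / 4 * ‖WithLp.toLp 2 x‖ ^ 2) =
      ∏ i, Real.exp (1 / 4 * x i ^ 2) := by
    intro x
    rw [EuclideanSpace.real_norm_sq_eq, Finset.mul_sum, Real.exp_sum]
  simp only [h]
  rw [← ofReal_integral_eq_lintegral_ofReal
      (Integrable.fintype_prod fun _ => integrable_exp_quarter_sq_gaussianReal)
      (ae_of_all _ fun x => Finset.prod_nonneg fun i _ => (Real.exp_pos _).le),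
    integral_fintype_prod_eq_prod (f := fun _ x => Real.exp (1 / 4 * x ^ 2))]
  simp only [integral_exp_quarter_sq_gaussianReal, Finset.prod_const, Finset.card_univ,
    Fintype.card_fin]

/-- A linear combination of independent standard Gaussian vectors, with coefficients `y`, is
distributed as `‖y‖` times a standard Gaussian vector. -/
lemma map_pi_stdGaussian_linearCombination {n p : ℕ} (y : EuclideanSpace ℝ (Fin n)) :
    (Measure.pi fun _ : Fin n => stdGaussian (EuclideanSpace ℝ (Fin p))).map
        (fun e => ∑ i, y i • e i) =
      (stdGaussian (EuclideanSpace ℝ (Fin p))).map (fun x => ‖y‖ • x) := by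
  have hprob : ∀ i : Fin n, IsProbabilityMeasure
      ((stdGaussian (EuclideanSpace ℝ (Fin p))).map fun x => y i • x) := fun i =>
    Measure.isProbabilityMeasure_map (by fun_prop)
  have hcomp : (Measure.pi fun _ : Fin n => stdGaussian (EuclideanSpace ℝ (Fin p))).map
        (fun e => ∑ i, y i • e i) =
      (Measure.pi fun i : Fin n =>
        (stdGaussian (EuclideanSpace ℝ (Fin p))).map fun x => y i • x).map
          (fun e => ∑ i, e i) := by
    rw [← Measure.pi_map_pi (fun i => by fun_prop), Measure.map_map (by fun_prop) (by fun_prop)]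
    rfl
  rw [hcomp]
  have := Measure.isProbabilityMeasure_map
    (μ := stdGaussian (EuclideanSpace ℝ (Fin p))) (f := fun x => ‖y‖ • x) (by fun_prop)
  have : IsProbabilityMeasure ((Measure.pi fun i : Fin n =>
        (stdGaussian (EuclideanSpace ℝ (Fin p))).map fun x => y i • x).map
          (fun e => ∑ i, e i)) := Measure.isProbabilityMeasure_map (by fun_prop)
  apply Measure.ext_of_charFun
  rw [charFun_map_sum_pi_eq_prod]
  ext t
  rw [Finset.prod_apply]
  simp only [charFun_map_smul, charFun_stdGaussian]
  rw [← Complex.exp_sum]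
  congr 1
  simp only [norm_smul, Real.norm_eq_abs, mul_pow, ← Complex.ofReal_pow, sq_abs,
    EuclideanSpace.real_norm_sq_eq y]
  push_cast
  rw [← Finset.sum_div, Finset.sum_neg_distrib, Finset.sum_mul]

/-- The exponents match because `4/25 * (5/4)² = 1/4`. -/
lemma lintegral_exp_norm_sq_linearCombination_le {n p : ℕ} (y : EuclideanSpace ℝ (Fin n))
    (hy : ‖y‖ ≤ 5 / 4) :
    ∫⁻ e, ENNReal.ofReal (Real.exp (4 / 25 * ‖∑ i, y i • e i‖ ^ 2))
      ∂(Measure.pi fun _ : Fin n => stdGaussian (EuclideanSpace ℝ (Fin p))) ≤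
      ENNReal.ofReal (√2 ^ p) := by
  have h := map_pi_stdGaussian_linearCombination (p := p) y
  calc _ = ∫⁻ x, ENNReal.ofReal (Real.exp (4 / 25 * ‖x‖ ^ 2))
        ∂((Measure.pi fun _ : Fin n => stdGaussian (EuclideanSpace ℝ (Fin p))).map
          (fun e => ∑ i, y i • e i)) := by
        rw [lintegral_map (by fun_prop) (by fun_prop)]
    _ = ∫⁻ x, ENNReal.ofReal (Real.exp (4 / 25 * ‖‖y‖ • x‖ ^ 2))
        ∂(stdGaussian (EuclideanSpace ℝ (Fin p))) := by
        rw [h, lintegral_map (by fun_prop) (by fun_prop)]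
    _ ≤ ∫⁻ x, ENNReal.ofReal (Real.exp (1 / 4 * ‖x‖ ^ 2))
        ∂(stdGaussian (EuclideanSpace ℝ (Fin p))) := by
        refine lintegral_mono fun x => ENNReal.ofReal_le_ofReal (Real.exp_le_exp.2 ?_)
        rw [norm_smul, norm_norm, mul_pow]
        have h2 : ‖y‖ ^ 2 ≤ 25 / 16 := by nlinarith [norm_nonneg y]
        nlinarith [sq_nonneg ‖x‖]
    _ = _ := lintegral_exp_quarter_norm_sq_stdGaussian p

/-- The linear map whose matrix has columns `e i`. -/
noncomputable def columnMap {n p : ℕ} (e : Fin n → EuclideanSpace ℝ (Fin p)) :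
    EuclideanSpace ℝ (Fin n) →L[ℝ] EuclideanSpace ℝ (Fin p) :=
  ∑ i, (EuclideanSpace.proj i : EuclideanSpace ℝ (Fin n) →L[ℝ] ℝ).smulRight (e i)

@[simp]
lemma columnMap_apply {n p : ℕ} (e : Fin n → EuclideanSpace ℝ (Fin p))
    (y : EuclideanSpace ℝ (Fin n)) : columnMap e y = ∑ i, y i • e i := by
  simp [columnMap]

/-- An exponential moment of `‖T y‖` over a ball controls the operator norm of `T`. -/
lemma exp_opNorm_sq_mul_volume_le_lintegral {n p : ℕ}
    (T : EuclideanSpace ℝ (Fin n) →L[ℝ] EuclideanSpace ℝ (Fin p)) {M : ℝ}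
    (hM : 0 ≤ M) (hT : M < ‖T‖ ^ 2) :
    ENNReal.ofReal (Real.exp (M / 25)) *
        volume (Metric.ball (0 : EuclideanSpace ℝ (Fin n)) (1 / 4)) ≤
      ∫⁻ y in Metric.ball (0 : EuclideanSpace ℝ (Fin n)) (5 / 4),
        ENNReal.ofReal (Real.exp (4 / 25 * ‖T y‖ ^ 2)) := by
  have hpos : 0 < ‖T‖ := by
    rcases (norm_nonneg T).eq_or_lt with h | h
    · rw [← h] at hT
      norm_num at hT
      linarith
    · exact h
  -- Moving by at most `1/4` from this near-maximizer still leaves `3/4 - 1/4 = 1/2` of the operator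
  -- norm.
  obtain ⟨x, hx1, hx⟩ := T.exists_lt_apply_of_lt_opNorm
    (show 3 / 4 * ‖T‖ < ‖T‖ by linarith)
  have hsub : Metric.ball x (1 / 4) ⊆ Metric.ball 0 (5 / 4) := by
    apply Metric.ball_subset_ball'
    rw [dist_zero_right]
    linarith
  calc _ = ∫⁻ _ in Metric.ball x (1 / 4), ENNReal.ofReal (Real.exp (M / 25)) := by
        rw [setLIntegral_const, Measure.addHaar_ball_center volume x]
    _ ≤ ∫⁻ y in Metric.ball x (1 / 4), ENNReal.ofReal (Real.exp (4 / 25 * ‖T y‖ ^ 2)) := by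
        refine setLIntegral_mono (by fun_prop) fun y hy => ?_
        apply ENNReal.ofReal_le_ofReal
        rw [Real.exp_le_exp]
        have h1 : ‖T x - T y‖ ≤ ‖T‖ * (1 / 4) := by
          rw [← map_sub]
          refine (T.le_opNorm _).trans ?_
          gcongr
          rw [← dist_eq_norm, dist_comm]
          exact (Metric.mem_ball.1 hy).le
        have h2 : ‖T‖ / 2 ≤ ‖T y‖ := by linarith [norm_sub_norm_le (T x) (T y)]
        nlinarith
    _ ≤ _ := lintegral_mono_set hsub

/-- The numerical content of the Markov bound: `5 ^ n` is the volume ratio of the balls of radii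
`5/4` and `1/4`, `√2 ^ p` the Gaussian moment, and `2 (n + p)` is `50 (n + p) / 25`. -/
lemma five_pow_mul_sqrt_two_pow_mul_exp_le (n p : ℕ) :
    5 ^ n * √2 ^ p * Real.exp (-(2 * (n + p))) ≤ Real.exp (-0.08 * n) := by
  have h5 : (5 : ℝ) ≤ Real.exp (1.9) := by
    have h1 := Real.exp_one_gt_d9
    have h2 : (5 : ℝ) ^ 10 ≤ Real.exp 1 ^ 19 :=
      le_trans (by norm_num) (pow_le_pow_left₀ (by norm_num) h1.le 19)
    have h3 : Real.exp 1 ^ 19 = Real.exp 1.9 ^ 10 := by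
      rw [← Real.exp_nat_mul, ← Real.exp_nat_mul]; norm_num
    rw [h3] at h2
    exact le_of_pow_le_pow_left₀ (by norm_num) (Real.exp_pos _).le h2
  have h2 : √2 ≤ Real.exp 2 := by
    have : √2 ≤ 2 := by rw [Real.sqrt_le_left (by norm_num)]; norm_num
    linarith [Real.add_one_le_exp (2 : ℝ)]
  calc 5 ^ n * √2 ^ p * Real.exp (-(2 * (n + p)))
      ≤ Real.exp 1.9 ^ n * Real.exp 2 ^ p * Real.exp (-(2 * (n + p))) := by gcongr
    _ = Real.exp (-0.1 * n) := by
        rw [← Real.exp_nat_mul, ← Real.exp_nat_mul, ← Real.exp_add, ← Real.exp_add]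
        congr 1
        ring
    _ ≤ _ := by
        rw [Real.exp_le_exp]
        have : (0 : ℝ) ≤ n := n.cast_nonneg
        linarith

/-- The squared operator norm of a `p × n` standard Gaussian matrix exceeds `50 (n + p)` with
exponentially small probability. -/
lemma pi_stdGaussian_opNorm_sq_columnMap_gt_le (n p : ℕ) :
    (Measure.pi fun _ : Fin n => stdGaussian (EuclideanSpace ℝ (Fin p)))
        {e | 50 * ((n : ℝ) + p) < ‖columnMap e‖ ^ 2} ≤
      ENNReal.ofReal (Real.exp (-0.08 * n)) := by
  set ν := Measure.pi fun _ : Fin n => stdGaussian (EuclideanSpace ℝ (Fin p)) with hν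
  set F : (Fin n → EuclideanSpace ℝ (Fin p)) → ENNReal := fun e =>
    ∫⁻ y in Metric.ball (0 : EuclideanSpace ℝ (Fin n)) (5 / 4),
      ENNReal.ofReal (Real.exp (4 / 25 * ‖columnMap e y‖ ^ 2)) with hF
  have hmeas : Measurable (Function.uncurry fun (e : Fin n → EuclideanSpace ℝ (Fin p))
      (y : EuclideanSpace ℝ (Fin n)) =>
        ENNReal.ofReal (Real.exp (4 / 25 * ‖columnMap e y‖ ^ 2))) := by
    simp only [columnMap_apply, Function.uncurry_def]
    fun_prop
  have hFm : Measurable F := hmeas.lintegral_prod_right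
  set V := volume (Metric.ball (0 : EuclideanSpace ℝ (Fin n)) 1) with hV
  have hV0 : V ≠ 0 := (Metric.measure_ball_pos _ _ one_pos).ne'
  have hVt : V ≠ ⊤ := measure_ball_lt_top.ne
  have hint : ∫⁻ e, F e ∂ν ≤ ENNReal.ofReal (√2 ^ p) * (ENNReal.ofReal ((5 / 4) ^ n) * V) := by
    rw [hF, lintegral_lintegral_swap hmeas.aemeasurable]
    calc _ ≤ ∫⁻ _ in Metric.ball (0 : EuclideanSpace ℝ (Fin n)) (5 / 4),
          ENNReal.ofReal (√2 ^ p) := by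
          refine setLIntegral_mono measurable_const fun y hy => ?_
          simp only [columnMap_apply]
          exact lintegral_exp_norm_sq_linearCombination_le y (mem_ball_zero_iff.1 hy).le
      _ = _ := by
          rw [setLIntegral_const, Measure.addHaar_ball_of_pos _ _ (by norm_num)]
          simp [hV]
  -- The lower bound that a large operator norm forces on `F`, used as the Markov threshold.
  set a := ENNReal.ofReal (Real.exp (2 * (n + p))) * (ENNReal.ofReal ((1 / 4) ^ n) * V) with ha
  have hsub : {e | 50 * ((n : ℝ) + p) < ‖columnMap e‖ ^ 2} ⊆ {e | a ≤ F e} := by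
    intro e he
    have := exp_opNorm_sq_mul_volume_le_lintegral (columnMap e) (by positivity) he
    rw [Measure.addHaar_ball_of_pos _ _ (by norm_num)] at this
    simp only [finrank_euclideanSpace, Fintype.card_fin] at this
    rwa [show 50 * ((n : ℝ) + p) / 25 = 2 * (n + p) by ring] at this
  have ha0 : a ≠ 0 := by
    simp only [ha, ne_eq, mul_eq_zero, ENNReal.ofReal_eq_zero, not_or, not_le]
    exact ⟨Real.exp_pos _, by positivity, hV0⟩
  have hat : a ≠ ⊤ := by finiteness
  have hmarkov := (mul_meas_ge_le_lintegral₀ (μ := ν) hFm.aemeasurable a).trans hint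
  refine (measure_mono hsub).trans ?_
  refine (ENNReal.mul_le_mul_iff_right ha0 hat).1 (hmarkov.trans ?_)
  rw [ha]
  calc ENNReal.ofReal (√2 ^ p) * (ENNReal.ofReal ((5 / 4) ^ n) * V)
      = ENNReal.ofReal (√2 ^ p * (5 / 4) ^ n) * V := by
        rw [ENNReal.ofReal_mul (by positivity), mul_assoc]
    _ ≤ ENNReal.ofReal (Real.exp (2 * (n + p)) * (1 / 4) ^ n * Real.exp (-0.08 * n)) * V := by
        gcongr ENNReal.ofReal ?_ * V
        have h := five_pow_mul_sqrt_two_pow_mul_exp_le n p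
        rw [Real.exp_neg, ← div_eq_mul_inv, div_le_iff₀ (Real.exp_pos _)] at h
        calc √2 ^ p * (5 / 4 : ℝ) ^ n = (5 ^ n * √2 ^ p) * (1 / 4) ^ n := by
              rw [div_pow, div_pow]; ring
          _ ≤ (Real.exp (-0.08 * n) * Real.exp (2 * (n + p))) * (1 / 4) ^ n := by gcongr
          _ = Real.exp (2 * (n + p)) * (1 / 4) ^ n * Real.exp (-0.08 * n) := by ring
    _ = _ := by
        rw [ENNReal.ofReal_mul (by positivity), ENNReal.ofReal_mul (by positivity)]
        ring

/-- For independent standard Gaussian columns there is a measurable event of probability at least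
`1 - exp (-0.08 n)` on which the squared operator norm of the noise matrix is at most
`50 (n + p)`. -/
lemma exists_event_opNorm_sq_columnMap_le {n p : ℕ} {Ω : Type*} [MeasurableSpace Ω]
    (μ : Measure Ω) [IsProbabilityMeasure μ] (ε : Fin n → Ω → EuclideanSpace ℝ (Fin p))
    (hind : iIndepFun ε μ)
    (hlaw : ∀ i, HasLaw (ε i) (stdGaussian (EuclideanSpace ℝ (Fin p))) μ) :
    ∃ A : Set Ω, MeasurableSet A ∧ 1 - Real.exp (-0.08 * (n : ℝ)) ≤ μ.real A ∧
      ∀ ω ∈ A, ‖columnMap fun i => ε i ω‖ ^ 2 ≤ 50 * ((n : ℝ) + p) := by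
  set S : Set (Fin n → EuclideanSpace ℝ (Fin p)) :=
    {e | 50 * ((n : ℝ) + p) < ‖columnMap e‖ ^ 2}
  set B : Set Ω := (fun ω i => ε i ω) ⁻¹' S
  have hB : μ B ≤ ENNReal.ofReal (Real.exp (-0.08 * n)) := by
    have hae : ∀ i, AEMeasurable (ε i) μ := fun i => (hlaw i).aemeasurable
    have hmap : μ.map (fun ω i => ε i ω) =
        Measure.pi fun _ : Fin n => stdGaussian (EuclideanSpace ℝ (Fin p)) := by
      rw [(iIndepFun_iff_map_fun_eq_pi_map hae).1 hind]
      simp only [(hlaw _).map_eq]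
    refine (Measure.le_map_apply (aemeasurable_pi_lambda _ hae) S).trans ?_
    rw [hmap]
    exact pi_stdGaussian_opNorm_sq_columnMap_gt_le n p
  -- Passing to a measurable hull of the bad event keeps its measure and makes the good event
  -- measurable.
  refine ⟨(toMeasurable μ B)ᶜ, (measurableSet_toMeasurable μ B).compl, ?_, ?_⟩
  · rw [probReal_compl_eq_one_sub (measurableSet_toMeasurable μ B), Measure.real,
      measure_toMeasurable]
    have := ENNReal.toReal_mono ENNReal.ofReal_ne_top hB
    rw [ENNReal.toReal_ofReal (Real.exp_pos _).le] at this
    linarith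
  · intro ω hω
    by_contra hcon
    exact hω (subset_toMeasurable μ B (not_le.1 hcon))

end Gaussian

end SpectralClustering

namespace SpectralClustering

/-! ### Projection onto an orthonormal family -/

section Projection

variable {r p n : ℕ} {w : Fin r → EuclideanSpace ℝ (Fin p)}

lemma norm_sq_sum_smul_of_orthonormal {ι E : Type*} [Fintype ι] [NormedAddCommGroup E]
    [InnerProductSpace ℝ E] {u : ι → E} (hu : Orthonormal ℝ u) (a : ι → ℝ) :
    ‖∑ l, a l • u l‖ ^ 2 = ∑ l, a l ^ 2 := by
  rw [← real_inner_self_eq_norm_sq, hu.inner_sum]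
  simp [sq]

/-- The part of `x` orthogonal to the orthonormal family `w`. -/
noncomputable def residual (w : Fin r → EuclideanSpace ℝ (Fin p)) :
    EuclideanSpace ℝ (Fin p) →ₗ[ℝ] EuclideanSpace ℝ (Fin p) :=
  LinearMap.id - ∑ l, (innerₛₗ ℝ (w l)).smulRight (w l)

lemma residual_apply (w : Fin r → EuclideanSpace ℝ (Fin p)) (x : EuclideanSpace ℝ (Fin p)) :
    residual w x = x - ∑ l, inner ℝ (w l) x • w l := by
  simp [residual]

lemma norm_residual_le (hw : Orthonormal ℝ w) (x : EuclideanSpace ℝ (Fin p)) :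
    ‖residual w x‖ ≤ ‖x‖ := by
  have h : ‖residual w x‖ ^ 2 ≤ ‖x‖ ^ 2 := by
    rw [residual_apply, norm_sub_sq_real, norm_sq_sum_smul_of_orthonormal hw, inner_sum]
    have h1 : ∀ l, inner ℝ x (inner ℝ (w l) x • w l) = inner ℝ (w l) x ^ 2 := by
      intro l
      rw [real_inner_smul_right, real_inner_comm, sq]
    simp only [h1]
    have : 0 ≤ ∑ l, inner ℝ (w l) x ^ 2 := Finset.sum_nonneg fun _ _ => sq_nonneg _
    linarith
  exact le_of_pow_le_pow_left₀ two_ne_zero (norm_nonneg _) h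

lemma residual_self (hw : Orthonormal ℝ w) (l : Fin r) : residual w (w l) = 0 := by
  rw [residual_apply, sub_eq_zero]
  simp [orthonormal_iff_ite.1 hw]

lemma residual_of_orthogonal {x : EuclideanSpace ℝ (Fin p)} (hx : ∀ l, inner ℝ (w l) x = 0) :
    residual w x = x := by
  simp [residual_apply, hx]

/-- With `E` the matrix of columns `e i`, the left side is `‖Eᵀx‖²`; apply `E` to `y = Eᵀx` and use
`⟨x, E y⟩ = ‖y‖²`. -/
lemma sum_inner_sq_le_opNorm_sq_columnMap (e : Fin n → EuclideanSpace ℝ (Fin p))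
    {x : EuclideanSpace ℝ (Fin p)} (hx : ‖x‖ = 1) :
    ∑ i, inner ℝ x (e i) ^ 2 ≤ ‖columnMap e‖ ^ 2 := by
  set y : EuclideanSpace ℝ (Fin n) := WithLp.toLp 2 fun i => inner ℝ x (e i) with hy
  have hyn : ‖y‖ ^ 2 = ∑ i, inner ℝ x (e i) ^ 2 := EuclideanSpace.real_norm_sq_eq y
  have h1 : inner ℝ x (columnMap e y) = ‖y‖ ^ 2 := by
    rw [columnMap_apply, inner_sum, hyn]
    refine Finset.sum_congr rfl fun i _ => ?_
    rw [real_inner_smul_right, sq]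
  have h2 : ‖y‖ ^ 2 ≤ ‖columnMap e‖ * ‖y‖ := by
    rw [← h1]
    refine (real_inner_le_norm _ _).trans ?_
    rw [hx, one_mul]
    exact (columnMap e).le_opNorm y
  have h3 : ‖y‖ ≤ ‖columnMap e‖ := by
    rcases (norm_nonneg y).eq_or_lt with h | h
    · rw [← h]; positivity
    · rw [sq] at h2
      exact le_of_mul_le_mul_right h2 h
  rw [← hyn]
  gcongr

lemma sum_sum_inner_sq_le (hw : Orthonormal ℝ w) (e : Fin n → EuclideanSpace ℝ (Fin p)) :
    ∑ i, ∑ l, inner ℝ (w l) (e i) ^ 2 ≤ r * ‖columnMap e‖ ^ 2 := by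
  rw [Finset.sum_comm]
  calc _ ≤ ∑ _l : Fin r, ‖columnMap e‖ ^ 2 :=
        Finset.sum_le_sum fun l _ => sum_inner_sq_le_opNorm_sq_columnMap e (hw.norm_eq_one l)
    _ = _ := by simp

end Projection

/-! ### Singular subspaces of a low-rank matrix plus noise -/

section SingularSubspace

variable {p n k : ℕ} {X : Fin n → EuclideanSpace ℝ (Fin p)} {σ : Fin (min p n) → ℝ}
  {u : Fin (min p n) → EuclideanSpace ℝ (Fin p)} {v : Fin (min p n) → EuclideanSpace ℝ (Fin n)}

lemma IsSVD.columnMap_eq (h : IsSVD X σ u v) (y : EuclideanSpace ℝ (Fin n)) :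
    columnMap X y = ∑ l, (σ l * inner ℝ (v l) y) • u l := by
  rw [columnMap_apply]
  simp only [h.decomposition, Finset.smul_sum, smul_smul]
  rw [Finset.sum_comm]
  refine Finset.sum_congr rfl fun l _ => ?_
  rw [← Finset.sum_smul]
  congr 1
  rw [PiLp.inner_apply, Finset.mul_sum]
  refine Finset.sum_congr rfl fun i _ => ?_
  simp only [RCLike.inner_apply, conj_trivial]
  ring

/-- The singular value of a rank-`k` matrix plus noise with index `k` is at most the operator norm
of the noise. -/
lemma IsSVD.singularValue_le_opNorm_noise {θ : Fin k → EuclideanSpace ℝ (Fin p)}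
    {z : Fin n → Fin k} {e : Fin n → EuclideanSpace ℝ (Fin p)}
    (h : IsSVD (fun i => θ (z i) + e i) σ u v) {m : Fin (min p n)} (hm : k ≤ m) :
    σ m ≤ ‖columnMap e‖ := by
  have hkd : k + 1 ≤ min p n := by have := m.2; omega
  set ι : Fin (k + 1) → Fin (min p n) := Fin.castLE hkd
  have hι : Function.Injective ι := Fin.castLE_injective hkd
  have hv' : Orthonormal ℝ (v ∘ ι) := h.right_orthonormal.comp ι hι
  -- `f a` lists the cluster sums of `y = ∑ a l • v l`. These are `k` linear conditions on `k + 1`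
  -- unknowns, so some nonzero `y` satisfies them all, and the signal vanishes on it.
  set f : (Fin (k + 1) → ℝ) →ₗ[ℝ] (Fin k → ℝ) :=
    LinearMap.pi fun j => ∑ i with z i = j, ∑ l, (v (ι l) i) • LinearMap.proj l with hf
  have hfapp : ∀ a j, f a j = ∑ i with z i = j, ∑ l, v (ι l) i * a l := by
    intro a j
    simp [hf, LinearMap.sum_apply]
  obtain ⟨a, ha, ha0⟩ := (Submodule.ne_bot_iff _).1
    (LinearMap.ker_ne_bot_of_finrank_lt (f := f) (by simp))
  rw [LinearMap.mem_ker] at ha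
  set y : EuclideanSpace ℝ (Fin n) := ∑ l, a l • v (ι l) with hy
  have hyi : ∀ i, y i = ∑ l, v (ι l) i * a l := by
    intro i
    simp [hy, mul_comm]
  have hynorm : ‖y‖ ^ 2 = ∑ l, a l ^ 2 := norm_sq_sum_smul_of_orthonormal hv' a
  have hypos : 0 < ‖y‖ := by
    obtain ⟨l, hl⟩ := Function.ne_iff.1 ha0
    have : 0 < ∑ l, a l ^ 2 := Finset.sum_pos' (fun _ _ => sq_nonneg _)
      ⟨l, Finset.mem_univ _, by have : a l ≠ 0 := hl; positivity⟩
    rw [← hynorm] at this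
    exact lt_of_pow_lt_pow_left₀ 2 (norm_nonneg _) (by simpa using this)
  have hsignal : ∑ i, y i • θ (z i) = 0 := by
    rw [← Finset.sum_fiberwise (s := Finset.univ) (g := z)]
    refine Finset.sum_eq_zero fun j _ => ?_
    have h1 : ∑ i with z i = j, y i • θ (z i) = (∑ i with z i = j, y i) • θ j := by
      rw [Finset.sum_smul]
      refine Finset.sum_congr rfl fun i hi => ?_
      rw [(Finset.mem_filter.1 hi).2]
    have h2 := congrFun ha j
    rw [hfapp] at h2
    rw [h1]
    simp only [hyi, h2, Pi.zero_apply, zero_smul]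
  have hXe : columnMap (fun i => θ (z i) + e i) y = columnMap e y := by
    simp only [columnMap_apply, smul_add, Finset.sum_add_distrib, hsignal, zero_add]
  have hinner : ∀ l, inner ℝ (v (ι l)) y = a l := fun l => hv'.inner_right_fintype a l
  -- Indices start at `0`, so the `k + 1` vectors spanning `y` have indices at most `k ≤ m` and
  -- singular values at least `σ m`.
  have hlower : σ m ^ 2 * ‖y‖ ^ 2 ≤ ‖columnMap e y‖ ^ 2 := by
    rw [← hXe, h.columnMap_eq, norm_sq_sum_smul_of_orthonormal h.left_orthonormal, hynorm,
      Finset.mul_sum]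
    calc ∑ l, σ m ^ 2 * a l ^ 2 ≤ ∑ l, (σ (ι l) * inner ℝ (v (ι l)) y) ^ 2 := by
          refine Finset.sum_le_sum fun l _ => ?_
          rw [hinner, mul_pow]
          gcongr
          · exact h.nonneg m
          · refine h.antitone ?_
            have := l.2
            rw [Fin.le_def, Fin.val_castLE]
            omega
      _ = ∑ l ∈ Finset.univ.map ⟨ι, hι⟩, (σ l * inner ℝ (v l) y) ^ 2 := by
          rw [Finset.sum_map]
          rfl
      _ ≤ _ := Finset.sum_le_univ_sum_of_nonneg fun l => sq_nonneg _
  have hupper := (columnMap e).le_opNorm y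
  have h3 : (σ m * ‖y‖) ^ 2 ≤ (‖columnMap e‖ * ‖y‖) ^ 2 := by
    rw [mul_pow]
    exact hlower.trans (by gcongr)
  exact le_of_mul_le_mul_right (le_of_pow_le_pow_left₀ two_ne_zero (by positivity) h3) hypos

/-- The leading left singular vectors: the first `k` of them, or all if there are fewer. -/
def leadingVectors (k : ℕ) (u : Fin (min p n) → EuclideanSpace ℝ (Fin p)) :
    Fin (min k (min p n)) → EuclideanSpace ℝ (Fin p) :=
  fun l => u (Fin.castLE (min_le_right k (min p n)) l)

lemma orthonormal_leadingVectors (hu : Orthonormal ℝ u) : Orthonormal ℝ (leadingVectors k u) :=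
  hu.comp _ (Fin.castLE_injective _)

lemma residual_leadingVectors (hu : Orthonormal ℝ u) (l : Fin (min p n)) :
    residual (leadingVectors k u) (u l) = if (l : ℕ) < k then 0 else u l := by
  split_ifs with hl
  · exact residual_self (orthonormal_leadingVectors hu) ⟨l, lt_min hl l.2⟩
  · refine residual_of_orthogonal fun m => hu.inner_eq_zero fun hml => hl ?_
    have := congrArg Fin.val hml
    rw [Fin.val_castLE] at this
    have := m.2
    omega

/-- Projecting the data matrix away from its `k` leading left singular vectors leaves a matrix with
operator norm at most that of the noise. -/
lemma IsSVD.norm_residual_columnMap_le {θ : Fin k → EuclideanSpace ℝ (Fin p)}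
    {z : Fin n → Fin k} {e : Fin n → EuclideanSpace ℝ (Fin p)}
    (h : IsSVD (fun i => θ (z i) + e i) σ u v) (y : EuclideanSpace ℝ (Fin n)) :
    ‖residual (leadingVectors k u) (columnMap (fun i => θ (z i) + e i) y)‖ ≤
      ‖columnMap e‖ * ‖y‖ := by
  have h1 : residual (leadingVectors k u) (columnMap (fun i => θ (z i) + e i) y) =
      ∑ l : Fin (min p n), (if (l : ℕ) < k then 0 else σ l * inner ℝ (v l) y) • u l := by
    rw [h.columnMap_eq, map_sum]
    refine Finset.sum_congr rfl fun l _ => ?_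
    rw [map_smul, residual_leadingVectors h.left_orthonormal]
    split_ifs <;> simp
  refine le_of_pow_le_pow_left₀ two_ne_zero (by positivity) ?_
  rw [h1, norm_sq_sum_smul_of_orthonormal h.left_orthonormal, mul_pow]
  calc _ ≤ ∑ l, ‖columnMap e‖ ^ 2 * ‖inner ℝ (v l) y‖ ^ 2 := by
        refine Finset.sum_le_sum fun l _ => ?_
        split_ifs with hl
        · rw [zero_pow two_ne_zero]
          positivity
        · rw [mul_pow, Real.norm_eq_abs, sq_abs]
          gcongr
          · exact h.nonneg l
          · exact h.singularValue_le_opNorm_noise (not_lt.1 hl)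
    _ ≤ _ := by
        rw [← Finset.mul_sum]
        gcongr
        exact h.right_orthonormal.sum_inner_products_le y

/-- The centers are close to the leading left singular subspace, in an average sense. -/
lemma IsSVD.card_mul_norm_sq_residual_center_le {θ : Fin k → EuclideanSpace ℝ (Fin p)}
    {z : Fin n → Fin k} {e : Fin n → EuclideanSpace ℝ (Fin p)}
    (h : IsSVD (fun i => θ (z i) + e i) σ u v) (j : Fin k) :
    ((Finset.univ.filter fun i => z i = j).card : ℝ) *
      ‖residual (leadingVectors k u) (θ j)‖ ^ 2 ≤ 4 * ‖columnMap e‖ ^ 2 := by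
  set N : ℝ := ((Finset.univ.filter fun i => z i = j).card : ℝ) with hN
  -- The signal sends the cluster indicator `y` to `N • θ j`, while `‖y‖² = N`; squaring the
  -- operator bound leaves one factor `N`.
  set y : EuclideanSpace ℝ (Fin n) := WithLp.toLp 2 fun i => if z i = j then 1 else 0 with hy
  have hynorm : ‖y‖ ^ 2 = N := by
    rw [EuclideanSpace.real_norm_sq_eq]
    simp [hy, hN]
  have hsignal : N • θ j = columnMap (fun i => θ (z i) + e i) y - columnMap e y := by
    simp only [columnMap_apply, smul_add, Finset.sum_add_distrib, add_sub_cancel_right]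
    simp only [hy, ite_smul, one_smul, zero_smul]
    rw [← Finset.sum_filter, Finset.sum_congr rfl (g := fun _ => θ j)
      fun i hi => by rw [(Finset.mem_filter.1 hi).2]]
    simp [hN, Nat.cast_smul_eq_nsmul]
  have h1 : N * ‖residual (leadingVectors k u) (θ j)‖ ≤ 2 * ‖columnMap e‖ * ‖y‖ := by
    calc _ = ‖residual (leadingVectors k u) (N • θ j)‖ := by
          rw [map_smul, norm_smul, Real.norm_of_nonneg (by positivity)]
      _ ≤ ‖columnMap e‖ * ‖y‖ + ‖columnMap e‖ * ‖y‖ := by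
          rw [hsignal, map_sub]
          exact (norm_sub_le _ _).trans (add_le_add (h.norm_residual_columnMap_le y)
            ((norm_residual_le (orthonormal_leadingVectors h.left_orthonormal) _).trans
              ((columnMap e).le_opNorm y)))
      _ = _ := by ring
  rcases (show 0 ≤ N by positivity).eq_or_lt with h0 | h0
  · rw [← h0, zero_mul]
    positivity
  · have h2 : (N * ‖residual (leadingVectors k u) (θ j)‖) ^ 2 ≤ (2 * ‖columnMap e‖ * ‖y‖) ^ 2 := by
      gcongr
    rw [mul_pow, mul_pow, hynorm] at h2
    refine le_of_mul_le_mul_left ?_ h0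
    calc _ = N ^ 2 * ‖residual (leadingVectors k u) (θ j)‖ ^ 2 := by ring
      _ ≤ _ := h2
      _ = _ := by ring

lemma IsSVD.sum_norm_sq_residual_center_le {θ : Fin k → EuclideanSpace ℝ (Fin p)}
    {z : Fin n → Fin k} {e : Fin n → EuclideanSpace ℝ (Fin p)}
    (h : IsSVD (fun i => θ (z i) + e i) σ u v) :
    ∑ i, ‖residual (leadingVectors k u) (θ (z i))‖ ^ 2 ≤ 4 * k * ‖columnMap e‖ ^ 2 := by
  rw [← Finset.sum_fiberwise (s := Finset.univ) (g := z)]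
  calc _ ≤ ∑ _j : Fin k, 4 * ‖columnMap e‖ ^ 2 := by
        refine Finset.sum_le_sum fun j _ => ?_
        refine le_trans (le_of_eq ?_) (h.card_mul_norm_sq_residual_center_le j)
        rw [Finset.sum_congr rfl (g := fun _ => ‖residual (leadingVectors k u) (θ j)‖ ^ 2)
          fun i hi => by rw [(Finset.mem_filter.1 hi).2]]
        simp
    _ = _ := by
        simp
        ring

/-- The estimated centers, lifted to the ambient space, are close to the true centers on average
over the data points. -/
lemma IsSVD.sum_norm_sq_lifted_center_sub_center_le {θ : Fin k → EuclideanSpace ℝ (Fin p)}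
    {z zhat : Fin n → Fin k} {e : Fin n → EuclideanSpace ℝ (Fin p)}
    {c : Fin k → EuclideanSpace ℝ (Fin (min k (min p n)))}
    (h : IsSVD (fun i => θ (z i) + e i) σ u v)
    (hc : IsKMeansSolution (projectedData k (fun i => θ (z i) + e i) u) zhat c) :
    ∑ i, ‖∑ l, c (zhat i) l • leadingVectors k u l - θ (z i)‖ ^ 2 ≤
      18 * k * ‖columnMap e‖ ^ 2 := by
  set w := leadingVectors k u with hwdef
  have hw : Orthonormal ℝ w := orthonormal_leadingVectors h.left_orthonormal
  set Y := projectedData k (fun i => θ (z i) + e i) u with hYdef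
  have hY : ∀ i l, Y i l = inner ℝ (w l) (θ (z i)) + inner ℝ (w l) (e i) := by
    intro i l
    rw [← inner_add_right]
    rfl
  have hnoise : ∑ i, ∑ l, inner ℝ (w l) (e i) ^ 2 ≤ k * ‖columnMap e‖ ^ 2 := by
    refine (sum_sum_inner_sq_le hw e).trans ?_
    gcongr
    exact min_le_left _ _
  -- Against the true labels with projected true centers, the k-means residuals are exactly the
  -- projected noise.
  have hfit : ∑ i, ‖Y i - c (zhat i)‖ ^ 2 ≤ k * ‖columnMap e‖ ^ 2 := by
    refine (hc z fun j => WithLp.toLp 2 fun l => inner ℝ (w l) (θ j)).trans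
      (le_trans (le_of_eq ?_) hnoise)
    refine Finset.sum_congr rfl fun i _ => ?_
    rw [EuclideanSpace.real_norm_sq_eq]
    refine Finset.sum_congr rfl fun l _ => ?_
    rw [PiLp.sub_apply, hY, PiLp.toLp_apply, add_sub_cancel_left]
  -- The error splits into projected noise, fitting error and lost signal; `3` is the cost of
  -- squaring a three-term sum. Summing gives `3 * (1 + 1 + 4) = 18`.
  have hpoint : ∀ i, ‖∑ l, c (zhat i) l • w l - θ (z i)‖ ^ 2 ≤
      3 * (‖Y i - c (zhat i)‖ ^ 2 + ∑ l, inner ℝ (w l) (e i) ^ 2 +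
        ‖residual w (θ (z i))‖ ^ 2) := by
    intro i
    have hdecomp : ∑ l, c (zhat i) l • w l - θ (z i) =
        ∑ l, inner ℝ (w l) (e i) • w l - ∑ l, (Y i - c (zhat i)) l • w l
          - residual w (θ (z i)) := by
      rw [residual_apply]
      simp only [PiLp.sub_apply, hY, sub_smul, add_smul, Finset.sum_sub_distrib,
        Finset.sum_add_distrib]
      abel
    rw [hdecomp, EuclideanSpace.real_norm_sq_eq (Y i - c (zhat i)),
      ← norm_sq_sum_smul_of_orthonormal hw, ← norm_sq_sum_smul_of_orthonormal hw]
    set x₁ := ∑ l, inner ℝ (w l) (e i) • w l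
    set x₂ := ∑ l, (Y i - c (zhat i)) l • w l
    set x₃ := residual w (θ (z i))
    have h1 : ‖x₁ - x₂ - x₃‖ ≤ ‖x₁‖ + ‖x₂‖ + ‖x₃‖ :=
      (norm_sub_le _ _).trans (add_le_add_left (norm_sub_le _ _) _)
    have h2 : ‖x₁ - x₂ - x₃‖ ^ 2 ≤ (‖x₁‖ + ‖x₂‖ + ‖x₃‖) ^ 2 := by gcongr
    nlinarith [sq_nonneg (‖x₁‖ - ‖x₂‖), sq_nonneg (‖x₁‖ - ‖x₃‖), sq_nonneg (‖x₂‖ - ‖x₃‖)]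
  refine (Finset.sum_le_sum fun i _ => hpoint i).trans ?_
  rw [← Finset.mul_sum, Finset.sum_add_distrib, Finset.sum_add_distrib]
  linarith [h.sum_norm_sq_residual_center_le]

end SingularSubspace

/-! ### From center estimates to labels -/

section Labels

/-- If the centers attached to the estimated labels are close on average to the true centers, then
up to a relabeling few labels are wrong. -/
lemma exists_perm_card_ne_le {n k : ℕ} {E : Type*} [NormedAddCommGroup E] {θ g : Fin k → E}
    {z zhat : Fin n → Fin k} {Δ B : ℝ} (hΔ : 0 < Δ)
    (hsep : ∀ j l, j ≠ l → Δ ≤ ‖θ j - θ l‖)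
    (hsum : ∑ i, ‖g (zhat i) - θ (z i)‖ ^ 2 ≤ B)
    (hsize : ∀ j, 4 * B / Δ ^ 2 < ((Finset.univ.filter fun i => z i = j).card : ℝ)) :
    ∃ φ : Equiv.Perm (Fin k),
      ((Finset.univ.filter fun i => φ (zhat i) ≠ z i).card : ℝ) ≤ 4 * B / Δ ^ 2 := by
  set S : Finset (Fin n) := Finset.univ.filter fun i => Δ / 2 ≤ ‖g (zhat i) - θ (z i)‖ with hS
  have hScard : (S.card : ℝ) ≤ 4 * B / Δ ^ 2 := by
    rw [le_div_iff₀ (by positivity)]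
    have h1 : ∑ _i ∈ S, (Δ / 2) ^ 2 ≤ B := by
      refine le_trans ?_ hsum
      refine (Finset.sum_le_sum fun i hi => ?_).trans
        (Finset.sum_le_univ_sum_of_nonneg fun i => sq_nonneg ‖g (zhat i) - θ (z i)‖)
      have := (Finset.mem_filter.1 hi).2
      gcongr
    rw [Finset.sum_const, nsmul_eq_mul] at h1
    linarith
  have hclose : ∀ i ∉ S, ‖g (zhat i) - θ (z i)‖ < Δ / 2 := by
    intro i hi
    simpa [hS] using hi
  have hlabel : ∀ i ∉ S, ∀ i' ∉ S, zhat i = zhat i' → z i = z i' := by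
    intro i hi i' hi' heq
    by_contra hne
    have h1 := hclose i hi
    have h2 := hclose i' hi'
    rw [← heq] at h2
    have h3 := norm_sub_le (g (zhat i) - θ (z i')) (g (zhat i) - θ (z i))
    rw [sub_sub_sub_cancel_left] at h3
    linarith [hsep _ _ hne]
  -- Each cluster has more points than `S`, hence a well-estimated representative.
  have hrep : ∀ j, ∃ i ∉ S, z i = j := by
    intro j
    by_contra hcon
    push Not at hcon
    have : (Finset.univ.filter fun i => z i = j) ⊆ S := fun i hi => by
      by_contra hiS
      exact hcon i hiS (Finset.mem_filter.1 hi).2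
    have h1 : ((Finset.univ.filter fun i => z i = j).card : ℝ) ≤ S.card := by
      exact_mod_cast Finset.card_le_card this
    linarith [hsize j]
  choose rep hrepS hrepz using hrep
  have hinj : Function.Injective fun j => zhat (rep j) := fun j l hjl => by
    rw [← hrepz j, ← hrepz l]
    exact hlabel _ (hrepS j) _ (hrepS l) hjl
  -- `ψ` sends a true label to the estimated label of its representative, so the relabeling sought
  -- is its inverse.
  set ψ : Equiv.Perm (Fin k) := Equiv.ofBijective _ (Finite.injective_iff_bijective.1 hinj) with hψ
  refine ⟨ψ.symm, le_trans ?_ hScard⟩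
  have hsub : (Finset.univ.filter fun i => ψ.symm (zhat i) ≠ z i) ⊆ S := by
    intro i hi
    by_contra hiS
    refine (Finset.mem_filter.1 hi).2 ?_
    have h1 : zhat (rep (ψ.symm (zhat i))) = zhat i := ψ.apply_symm_apply (zhat i)
    rw [← hrepz (ψ.symm (zhat i))]
    exact hlabel _ (hrepS _) _ hiS h1
  exact_mod_cast Finset.card_le_card hsub

lemma misclusteringError_le_of_perm {n k : ℕ} {z zstar : Fin n → Fin k} (φ : Equiv.Perm (Fin k)) :
    misclusteringError z zstar ≤
      (1 / (n : ℝ)) * ((Finset.univ.filter fun i : Fin n => φ (z i) ≠ zstar i).card : ℝ) :=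
  ciInf_le (Set.finite_range _).bddBelow φ

lemma minSeparation_le {p k : ℕ} (θ : Fin k → EuclideanSpace ℝ (Fin p)) {j l : Fin k}
    (hjl : j ≠ l) : minSeparation θ ≤ ‖θ j - θ l‖ :=
  ciInf_le (f := fun jl : {jl : Fin k × Fin k // jl.1 ≠ jl.2} => ‖θ jl.1.1 - θ jl.1.2‖)
    (Set.finite_range _).bddBelow ⟨(j, l), hjl⟩

/-- What the signal-to-noise condition says about `Δ` and the cluster sizes. -/
lemma signal_strong_of_ratio_ge {n p k : ℕ} {θ : Fin k → EuclideanSpace ℝ (Fin p)}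
    {zstar : Fin n → Fin k} {C : ℝ} (hC : 0 < C)
    (h : C ≤ minSeparation θ /
          (clusterBalance zstar ^ (-(1 / 2) : ℝ) * (k : ℝ) *
            (1 + (p : ℝ) / (n : ℝ)) ^ (1 / 2 : ℝ))) :
    0 < n ∧ 0 < minSeparation θ ∧ ∀ j, 0 < (Finset.univ.filter fun i => zstar i = j).card ∧
      C ^ 2 * k * ((n : ℝ) + p) ≤
        minSeparation θ ^ 2 * ((Finset.univ.filter fun i => zstar i = j).card : ℝ) := by
  set Δ := minSeparation θ
  set m : ℝ := ⨅ j : Fin k, ((Finset.univ.filter fun i : Fin n => zstar i = j).card : ℝ) with hm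
  have hβ : clusterBalance zstar = m / (n / k) := rfl
  set β := clusterBalance zstar
  have hm0 : 0 ≤ m := Real.iInf_nonneg fun _ => Nat.cast_nonneg _
  have hβ0 : 0 ≤ β := by rw [hβ]; positivity
  -- Degenerate cases are excluded by the ratio being nonzero: with `n`, `k` or the smallest cluster
  -- size equal to `0`, the conventions `x / 0 = 0` and `0 ^ (-1/2) = 0` would make it vanish.
  have hne := (hC.trans_le h).ne'
  have hβne : β ≠ 0 := by
    intro h0
    rw [h0, Real.zero_rpow (by norm_num)] at hne
    simp at hne
  have hn : 0 < (n : ℝ) := by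
    rcases (n.cast_nonneg (α := ℝ)).eq_or_lt with h0 | h0
    · rw [hβ, ← h0] at hβne
      simp at hβne
    · exact h0
  have hk : 0 < (k : ℝ) := by
    rcases (k.cast_nonneg (α := ℝ)).eq_or_lt with h0 | h0
    · rw [← h0] at hne
      simp at hne
    · exact h0
  have hmpos : 0 < m := by
    rcases hm0.eq_or_lt with h0 | h0
    · rw [hβ, ← h0] at hβne
      simp at hβne
    · exact h0
  have hβpos : 0 < β := hβ0.lt_of_ne' hβne
  set D := β ^ (-(1 / 2) : ℝ) * (k : ℝ) * (1 + (p : ℝ) / (n : ℝ)) ^ (1 / 2 : ℝ) with hD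
  have hDpos : 0 < D := by positivity
  have hCD : C * D ≤ Δ := (le_div_iff₀ hDpos).1 h
  have hDsq : D ^ 2 * m = k * (n + p) := by
    rw [hD, mul_pow, mul_pow, ← Real.rpow_natCast, ← Real.rpow_natCast (_ ^ _),
      ← Real.rpow_mul hβ0, ← Real.rpow_mul (by positivity)]
    norm_num
    rw [Real.rpow_neg_one, hβ]
    field_simp
  refine ⟨by exact_mod_cast hn, (by positivity : 0 < C * D).trans_le hCD, fun j => ?_⟩
  have hmj : m ≤ ((Finset.univ.filter fun i : Fin n => zstar i = j).card : ℝ) :=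
    ciInf_le (Set.finite_range _).bddBelow j
  refine ⟨by exact_mod_cast hmpos.trans_le hmj, ?_⟩
  calc C ^ 2 * k * ((n : ℝ) + p) = (C * D) ^ 2 * m := by rw [mul_pow, mul_assoc, mul_assoc, hDsq]
    _ ≤ _ := by gcongr

end Labels

end SpectralClustering

theorem proposition2p1 :
    ∃ C > (0 : ℝ), ∃ C' > (0 : ℝ),
      ∀ (n p k : ℕ), 2 ≤ k →
      ∀ (θ : Fin k → EuclideanSpace ℝ (Fin p)) (zstar : Fin n → Fin k),
      C ≤ SpectralClustering.minSeparation θ /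
          (SpectralClustering.clusterBalance zstar ^ (-(1 / 2) : ℝ) * (k : ℝ) *
            (1 + (p : ℝ) / (n : ℝ)) ^ (1 / 2 : ℝ)) →
      ∀ (Ω : Type*) [MeasurableSpace Ω] (μ : Measure Ω) [IsProbabilityMeasure μ]
        (ε : Fin n → Ω → EuclideanSpace ℝ (Fin p)),
      iIndepFun ε μ →
      (∀ i, HasLaw (ε i) (stdGaussian (EuclideanSpace ℝ (Fin p))) μ) →
      ∃ A : Set Ω, MeasurableSet A ∧
        1 - Real.exp (-0.08 * (n : ℝ)) ≤ μ.real A ∧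
        ∀ ω ∈ A, ∀ zhat : Fin n → Fin k,
          SpectralClustering.IsSpectralClusteringOutput (fun i => θ (zstar i) + ε i ω) zhat →
          SpectralClustering.misclusteringError zhat zstar ≤
            C' * (k : ℝ) * (1 + (p : ℝ) / (n : ℝ)) / SpectralClustering.minSeparation θ ^ 2 := by
  -- `3600 = 4 * 18 * 50` comes from counting errors of size `Δ/2`. The strict comparison with
  -- cluster sizes holds since `61² = 3721 > 3600`.
  refine ⟨61, by norm_num, 3600, by norm_num, ?_⟩
  intro n p k _ θ zstar hratio Ω _ μ _ ε hind hlaw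
  obtain ⟨hn, hΔ, hcluster⟩ := SpectralClustering.signal_strong_of_ratio_ge (by norm_num) hratio
  obtain ⟨A, hA, hμA, hnorm⟩ :=
    SpectralClustering.exists_event_opNorm_sq_columnMap_le μ ε hind hlaw
  refine ⟨A, hA, hμA, fun ω hω zhat ⟨σ, u, v, c, hsvd, hkm⟩ => ?_⟩
  set Δ := SpectralClustering.minSeparation θ
  have hn' : (0 : ℝ) < n := by exact_mod_cast hn
  have hsum := hsvd.sum_norm_sq_lifted_center_sub_center_le hkm
  have hB : 18 * (k : ℝ) * ‖SpectralClustering.columnMap fun i => ε i ω‖ ^ 2 ≤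
      900 * k * ((n : ℝ) + p) := by
    calc _ ≤ 18 * (k : ℝ) * (50 * ((n : ℝ) + p)) := by gcongr; exact hnorm ω hω
      _ = _ := by ring
  obtain ⟨φ, hφ⟩ := SpectralClustering.exists_perm_card_ne_le
    (g := fun j => ∑ l, c j l • SpectralClustering.leadingVectors k u l) hΔ
    (fun j l hjl => SpectralClustering.minSeparation_le θ hjl) (hsum.trans hB) (fun j => by
      obtain ⟨hpos, hj⟩ := hcluster j
      have hpos' : (0 : ℝ) < (Finset.univ.filter fun i => zstar i = j).card := by
        exact_mod_cast hpos
      have : 0 < Δ ^ 2 * ((Finset.univ.filter fun i => zstar i = j).card : ℝ) := by positivity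
      rw [div_lt_iff₀ (by positivity)]
      linarith)
  refine (SpectralClustering.misclusteringError_le_of_perm φ).trans ?_
  calc _ ≤ 1 / (n : ℝ) * (4 * (900 * k * ((n : ℝ) + p)) / Δ ^ 2) := by gcongr
    _ = _ := by
      field_simp
      ring
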